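/- Let $S=\prod_p p^{\varepsilon_p}$ be a supernatural number, that is, a formal product over all primes $p$ with exponents $\varepsilon_p\in\{0,1,2,\dots,\infty\}$; a positive integer $l$ divides $S$ (written $l\mid S$) if for every prime $p$ the exponent of $p$ in $l$ is at most $\varepsilon_p$. Let $$G_S=\{k/l\in\mathbb Q : k\in\mathbb Z,\ l\ge 1,\ l\mid S\}\subseteq\mathbb Q ,$$ $$\mathbb Z/S\mathbb Z=\varprojlim_{l\mid S}\mathbb Z/l\mathbb Z=\Big\{(x_l)_l\in\prod_{l\mid S}\mathbb Z/l\mathbb Z : x_l\equiv x_k \ (\mathrm{mod}\ k)\text{ whenever } k\mid l\Big\},$$ the latter with the subspace topology of the product of the discrete groups $\mathbb Z/l\mathbb Z$ (the odometer group), and let $q:\mathbb Z\to\mathbb Z/S\mathbb Z$, $q(x)=(x \bmod l)_{l}$. Then the cyclic subgroup $q(\mathbb Z)$ is dense in $\mathbb Z/S\mathbb Z$, and there is an isomorphism of abelian groups $$\mathrm{Ext}^1_{\mathbb Z}(G_S,\mathbb Z)\;\cong\;(\mathbb Z/S\mathbb Z)/q(\mathbb Z).$$ -/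

import Mathlib

/-- A supernatural number `∏ p ^ ε_p`, `ε_p ∈ {0, 1, …, ∞}`, given by its exponents. -/
@[ext]
structure Supernatural where
  /-- The exponent `ε_p` of the prime `p`. -/
  exp : Nat.Primes → ℕ∞

namespace Supernatural

/-- The product of supernatural numbers adds the exponents. -/
instance : Mul Supernatural := ⟨fun S T => ⟨fun p => S.exp p + T.exp p⟩⟩

instance : Dvd Supernatural := ⟨fun S T => ∃ S' : Supernatural, T = S * S'⟩

theorem dvd_iff {S T : Supernatural} : S ∣ T ↔ ∀ p, S.exp p ≤ T.exp p := by
  constructor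
  · rintro ⟨S', rfl⟩ p
    exact le_self_add
  · intro h
    refine ⟨⟨fun p => T.exp p - S.exp p⟩, ?_⟩
    ext1
    funext p
    exact (add_tsub_cancel_of_le (h p)).symm

/-- A positive integer as a supernatural number, through its prime factorization. -/
def ofPNat (l : ℕ+) : Supernatural := ⟨fun p => ((l : ℕ).factorization (p : ℕ) : ℕ∞)⟩

/-- The set of finite divisors of `S`. -/
def divisors (S : Supernatural) : Set ℕ+ := {l | ofPNat l ∣ S}

theorem one_mem_divisors (S : Supernatural) : 1 ∈ S.divisors := by
  refine dvd_iff.2 fun p => ?_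
  simp [ofPNat]

theorem lcm_mem_divisors {S : Supernatural} {k l : ℕ+} (hk : k ∈ S.divisors)
    (hl : l ∈ S.divisors) : PNat.lcm k l ∈ S.divisors := by
  refine dvd_iff.2 fun p => ?_
  have h1 := dvd_iff.1 hk p
  have h2 := dvd_iff.1 hl p
  simp only [ofPNat, PNat.lcm_coe] at h1 h2 ⊢
  rw [Nat.factorization_lcm k.ne_zero l.ne_zero, Finsupp.sup_apply]
  rcases le_total ((k : ℕ).factorization p) ((l : ℕ).factorization p) with h | h
  · rwa [sup_eq_right.2 h]
  · rwa [sup_eq_left.2 h]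

/-- The group `G_S = {k / l ∈ ℚ : k ∈ ℤ, l ∣ S}`. -/
def fractions (S : Supernatural) : AddSubgroup ℚ where
  carrier := {x | ∃ k : ℤ, ∃ l ∈ S.divisors, x = (k : ℚ) / ((l : ℕ) : ℚ)}
  zero_mem' := ⟨0, 1, S.one_mem_divisors, by simp⟩
  neg_mem' := by
    rintro _ ⟨k, l, hl, rfl⟩
    exact ⟨-k, l, hl, by push_cast; ring⟩
  add_mem' := by
    rintro _ _ ⟨k, l, hl, rfl⟩ ⟨k', l', hl', rfl⟩
    obtain ⟨a, ha⟩ := PNat.dvd_lcm_left l l'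
    obtain ⟨b, hb⟩ := PNat.dvd_lcm_right l l'
    refine ⟨k * (a : ℕ) + k' * (b : ℕ), PNat.lcm l l', lcm_mem_divisors hl hl', ?_⟩
    have ha' : ((PNat.lcm l l' : ℕ) : ℚ) = ((l : ℕ) : ℚ) * ((a : ℕ) : ℚ) := by
      rw [ha]; push_cast; rfl
    have hb' : ((PNat.lcm l l' : ℕ) : ℚ) = ((l' : ℕ) : ℚ) * ((b : ℕ) : ℚ) := by
      rw [hb]; push_cast; rfl
    have h1 : ((l : ℕ) : ℚ) ≠ 0 := by exact_mod_cast l.ne_zero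
    have h2 : ((l' : ℕ) : ℚ) ≠ 0 := by exact_mod_cast l'.ne_zero
    have h3 : ((a : ℕ) : ℚ) ≠ 0 := by exact_mod_cast a.ne_zero
    have h4 : ((b : ℕ) : ℚ) ≠ 0 := by exact_mod_cast b.ne_zero
    have e1 : (k : ℚ) / ((l : ℕ) : ℚ) = (k * (a : ℕ)) / ((PNat.lcm l l' : ℕ) : ℚ) := by
      rw [ha']; field_simp
    have e2 : (k' : ℚ) / ((l' : ℕ) : ℚ) = (k' * (b : ℕ)) / ((PNat.lcm l l' : ℕ) : ℚ) := by
      rw [hb']; field_simp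
    rw [e1, e2]
    push_cast
    ring

/-- The ring `ℤ/Sℤ`, the inverse limit of the rings `ℤ/lℤ` over the finite divisors `l` of `S`
along the reduction maps. As a subring of the product it carries the subspace topology of the
product of the discrete spaces `ℤ/lℤ`. -/
def odometer (S : Supernatural) : Subring (∀ l : S.divisors, ZMod ((l : ℕ+) : ℕ)) where
  carrier := {x | ∀ (k l : S.divisors) (h : ((k : ℕ+) : ℕ) ∣ ((l : ℕ+) : ℕ)),
    ZMod.castHom h (ZMod ((k : ℕ+) : ℕ)) (x l) = x k}
  zero_mem' := fun _ _ h => map_zero (ZMod.castHom h _)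
  one_mem' := fun _ _ h => map_one (ZMod.castHom h _)
  add_mem' := fun {x y} hx hy k l h => by
    rw [Pi.add_apply, map_add, hx, hy, Pi.add_apply]
  mul_mem' := fun {x y} hx hy k l h => by
    rw [Pi.mul_apply, map_mul, hx, hy, Pi.mul_apply]
  neg_mem' := fun {x} hx k l h => by
    rw [Pi.neg_apply, map_neg, hx, Pi.neg_apply]

/-- The homomorphism `q : ℤ → ℤ/Sℤ`, `q x = (x mod l)_l`. -/
def q (S : Supernatural) : ℤ →+ S.odometer where
  toFun x := ⟨fun l => (x : ZMod ((l : ℕ+) : ℕ)), fun _ _ h => map_intCast (ZMod.castHom h _) x⟩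
  map_zero' := by ext l; simp
  map_add' x y := by ext l; simp

end Supernatural

/-!
`ℝ` is divisible, hence an injective abelian group, so the sequence `ℤ → ℝ → ℝ/ℤ` identifies
`Ext¹(G_S, ℤ)` with the cokernel of `Hom(G_S, ℝ) → Hom(G_S, ℝ/ℤ)`. Since `G_S` is the union of the
cyclic groups `ℤ · (1/l)`, a homomorphism `f : G_S → A` is the same as a family `y_l = f (1/l)` with
`m y_{km} = y_k`. In particular `Hom(G_S, ℝ) = ℝ`, and the homomorphisms `G_S → ℝ/ℤ` that kill `1`
are the points of `ℤ/Sℤ`, because then `y_l` lies in the `l`-torsion `ℤ/lℤ` of `ℝ/ℤ`. Every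
homomorphism `G_S → ℝ/ℤ` can be made to kill `1` by subtracting some `g ↦ r g`, and `g ↦ r g` itself
kills `1` exactly when `r` is an integer: this leaves `(ℤ/Sℤ) / q(ℤ)`.
-/

open CategoryTheory Abelian

section ConnectingHom

universe w v u

variable {C : Type u} [Category.{v} C] [Abelian C] [HasExt.{w} C] {T : ShortComplex C}

/-- The connecting homomorphism `Hom(X, T₃) → Ext¹(X, T₁)` of a short exact sequence
`0 → T₁ → T₂ → T₃ → 0`. -/
noncomputable def extConnectingHom (hT : T.ShortExact) (X : C) : (X ⟶ T.X₃) →+ Ext X T.X₁ 1 :=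
  (hT.extClass.postcomp X (zero_add 1)).comp Ext.addEquiv₀.symm.toAddMonoidHom

theorem extConnectingHom_apply (hT : T.ShortExact) {X : C} (f : X ⟶ T.X₃) :
    extConnectingHom hT X f = (Ext.mk₀ f).comp hT.extClass (zero_add 1) :=
  rfl

theorem extConnectingHom_surjective [Injective T.X₂] (hT : T.ShortExact) (X : C) :
    Function.Surjective (extConnectingHom hT X) := by
  intro e
  obtain ⟨x, hx⟩ :=
    Ext.covariant_sequence_exact₁ X hT e (Ext.eq_zero_of_injective _) (zero_add 1)
  obtain ⟨f, rfl⟩ := Ext.addEquiv₀.symm.surjective x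
  exact ⟨f, hx⟩

theorem extConnectingHom_eq_zero_iff (hT : T.ShortExact) {X : C} (f : X ⟶ T.X₃) :
    extConnectingHom hT X f = 0 ↔ ∃ h : X ⟶ T.X₂, h ≫ T.g = f := by
  constructor
  · intro hf
    obtain ⟨x, hx⟩ := Ext.covariant_sequence_exact₃ X hT (Ext.mk₀ f) (zero_add 1) hf
    obtain ⟨h, rfl⟩ := Ext.addEquiv₀.symm.surjective x
    exact ⟨h, Ext.addEquiv₀.symm.injective ((Ext.mk₀_comp_mk₀ h T.g).symm.trans hx)⟩
  · rintro ⟨h, rfl⟩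
    rw [extConnectingHom_apply, ← Ext.mk₀_comp_mk₀, Ext.comp_assoc_of_second_deg_zero,
      hT.comp_extClass, Ext.comp_zero]

end ConnectingHom

section Character

/-- The short exact sequence `ℤ → ℝ → ℝ/ℤ` of abelian groups. -/
noncomputable def intRealCircle : ShortComplex (ModuleCat.{0} ℤ) :=
  ShortComplex.moduleCatMk (Int.castAddHom ℝ).toIntLinearMap
    (QuotientAddGroup.mk' (AddSubgroup.zmultiples (1 : ℝ))).toIntLinearMap <| by
      ext
      change (((1 : ℤ) : ℝ) : UnitAddCircle) = 0
      rw [Int.cast_one, AddCircle.coe_period]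

theorem intRealCircle_shortExact : intRealCircle.ShortExact where
  exact := by
    rw [ShortComplex.ShortExact.moduleCat_exact_iff_function_exact]
    intro x
    refine (AddCircle.coe_eq_zero_iff (1 : ℝ)).trans (exists_congr fun n => ?_)
    rw [zsmul_one]
    rfl
  mono_f := (ModuleCat.mono_iff_injective _).2 (Int.cast_injective (α := ℝ))
  epi_g := (ModuleCat.epi_iff_surjective _).2
    (QuotientAddGroup.mk'_surjective (AddSubgroup.zmultiples (1 : ℝ)))

instance injective_intRealCircle_X₂ : Injective intRealCircle.X₂ :=
  (AddCommGrpCat.injective_as_module_iff ℝ).2 inferInstance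

/-- The connecting homomorphism `Hom(G, ℝ/ℤ) → Ext¹(G, ℤ)` of the sequence `ℤ → ℝ → ℝ/ℤ`. -/
noncomputable def extOfCharacter (G : Type) [AddCommGroup G] :
    (G →+ UnitAddCircle) →+ Ext (ModuleCat.of ℤ G) (ModuleCat.of ℤ ℤ) 1 :=
  (extConnectingHom intRealCircle_shortExact (ModuleCat.of ℤ G)).comp
    (ModuleCat.homAddEquiv.symm.toAddMonoidHom.comp
      (addMonoidHomLequivInt ℤ).toAddEquiv.toAddMonoidHom)

variable {G : Type} [AddCommGroup G]

theorem extOfCharacter_surjective : Function.Surjective (extOfCharacter G) :=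
  (extConnectingHom_surjective intRealCircle_shortExact _).comp
    (ModuleCat.homAddEquiv.symm.surjective.comp (addMonoidHomLequivInt ℤ).surjective)

theorem extOfCharacter_eq_zero_iff (f : G →+ UnitAddCircle) :
    extOfCharacter G f = 0 ↔ ∃ h : G →+ ℝ, ∀ g, (h g : UnitAddCircle) = f g := by
  refine (extConnectingHom_eq_zero_iff intRealCircle_shortExact _).trans ⟨?_, ?_⟩
  · rintro ⟨h, hh⟩
    exact ⟨h.hom.toAddMonoidHom, ConcreteCategory.congr_hom hh⟩
  · rintro ⟨h, hh⟩
    exact ⟨ModuleCat.ofHom h.toIntLinearMap, ModuleCat.hom_ext (LinearMap.ext hh)⟩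

end Character

section ZModCircle

theorem toAddCircle_castHom {k l m : ℕ} [NeZero k] [NeZero l] (h : l = k * m) (x : ZMod l) :
    ZMod.toAddCircle (ZMod.castHom (Dvd.intro m h.symm) (ZMod k) x) =
      m • ZMod.toAddCircle x := by
  obtain ⟨a, rfl⟩ := ZMod.intCast_surjective x
  have hm : (m : ℝ) ≠ 0 := Nat.cast_ne_zero.2 (right_ne_zero_of_mul (h ▸ NeZero.ne l))
  rw [map_intCast, ZMod.toAddCircle_intCast, ZMod.toAddCircle_intCast, ← AddCircle.coe_nsmul,
    nsmul_eq_mul, h, Nat.cast_mul, mul_comm (k : ℝ), ← mul_div_assoc, mul_div_mul_left _ _ hm]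

theorem exists_toAddCircle_eq {n : ℕ} [NeZero n] {y : UnitAddCircle} (hy : n • y = 0) :
    ∃ x : ZMod n, ZMod.toAddCircle x = y := by
  obtain ⟨m, -, rfl⟩ := (AddCircle.nsmul_eq_zero_iff (NeZero.pos n)).1 hy
  exact ⟨m, by rw [ZMod.toAddCircle_natCast, mul_one]⟩

end ZModCircle

namespace Supernatural

variable {S : Supernatural}

instance : One S.divisors := ⟨⟨1, S.one_mem_divisors⟩⟩

theorem coe_one_divisors : (((1 : S.divisors) : ℕ+) : ℕ) = 1 :=
  rfl

theorem directed_dvd_divisors (S : Supernatural) :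
    Directed (· ∣ ·) fun l : S.divisors => (l : ℕ) := fun k l =>
  ⟨⟨PNat.lcm k l, lcm_mem_divisors k.2 l.2⟩, PNat.dvd_iff.1 (PNat.dvd_lcm_left _ _),
    PNat.dvd_iff.1 (PNat.dvd_lcm_right _ _)⟩

theorem dense_range_q (S : Supernatural) :
    Dense ((S.q.range : AddSubgroup S.odometer) : Set S.odometer) := by
  intro x
  rw [mem_closure_iff]
  rintro _ ⟨U, hU, rfl⟩ hx
  obtain ⟨I, u, hu, hIU⟩ := isOpen_pi_iff.1 hU x.1 hx
  obtain ⟨L, hL⟩ := S.directed_dvd_divisors.finset_le I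
  obtain ⟨a, ha⟩ := ZMod.intCast_surjective (x.1 L)
  have q_eq : ∀ l ∈ I, (S.q a).1 l = x.1 l := fun l hl => by
    rw [← x.2 l L (hL l hl), ← ha, map_intCast]
    rfl
  exact ⟨S.q a, hIU fun l hl => q_eq l hl ▸ (hu l hl).2, a, rfl⟩

section UnitFraction

/-- The element `1 / l` of `G_S`. -/
def unitFraction (l : S.divisors) : S.fractions :=
  ⟨1 / (l : ℕ), 1, l, l.2, by rw [Int.cast_one]⟩

theorem nsmul_unitFraction {k l : S.divisors} {m : ℕ} (h : (l : ℕ) = k * m) :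
    m • unitFraction l = unitFraction k := by
  have hm : (m : ℚ) ≠ 0 := Nat.cast_ne_zero.2 (right_ne_zero_of_mul (h ▸ l.1.ne_zero))
  ext
  change m • (1 / ((l : ℕ) : ℚ)) = 1 / ((k : ℕ) : ℚ)
  rw [nsmul_eq_mul, h, Nat.cast_mul, mul_one_div, div_mul_cancel_right₀ hm, one_div]

theorem nsmul_unitFraction_self (l : S.divisors) : (l : ℕ) • unitFraction l = unitFraction 1 :=
  nsmul_unitFraction (one_mul _).symm

theorem zsmul_unitFraction_injective (l : S.divisors) :
    Function.Injective fun a : ℤ => a • unitFraction l :=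
  smul_left_injective ℤ fun h =>
    one_div_ne_zero (Nat.cast_ne_zero.2 l.1.ne_zero) (congrArg (Subtype.val : S.fractions → ℚ) h)

theorem exists_eq_zsmul_unitFraction (g : S.fractions) :
    ∃ (a : ℤ) (l : S.divisors), g = a • unitFraction l := by
  obtain ⟨_, a, l, hl, rfl⟩ := g
  refine ⟨a, ⟨l, hl⟩, Subtype.ext ?_⟩
  change _ = a • (1 / ((l : ℕ) : ℚ))
  rw [zsmul_eq_mul, mul_one_div]

theorem addMonoidHom_ext_unitFraction {A : Type*} [AddCommGroup A] {f f' : S.fractions →+ A}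
    (h : ∀ l, f (unitFraction l) = f' (unitFraction l)) : f = f' := by
  ext g
  obtain ⟨a, l, rfl⟩ := exists_eq_zsmul_unitFraction g
  rw [map_zsmul, map_zsmul, h]

end UnitFraction

section DivisionFamily

variable {A : Type*} [AddCommGroup A]

/-- The group of families `(y_l)`, `l ∣ S`, in an abelian group `A` with `m y_{km} = y_k`; these are
the families of values at the unit fractions of the homomorphisms `G_S → A`. -/
def divisionFamilies (S : Supernatural) (A : Type*) [AddCommGroup A] :
    AddSubgroup (S.divisors → A) where
  carrier := {y | ∀ ⦃k l : S.divisors⦄ ⦃m : ℕ⦄, (l : ℕ) = k * m → m • y l = y k}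
  zero_mem' := fun _ _ _ _ => nsmul_zero _
  add_mem' := fun hy hz _ _ _ h => (nsmul_add _ _ _).trans (congrArg₂ _ (hy h) (hz h))
  neg_mem' := fun hy _ _ _ h => (smul_neg _ _).trans (congrArg _ (hy h))

theorem exists_zsmul_unitFraction_eq_zsmul (y : S.divisionFamilies A) (a : ℤ) {k l : S.divisors}
    (h : (k : ℕ) ∣ l) :
    ∃ b : ℤ, a • unitFraction k = b • unitFraction l ∧ a • y.1 k = b • y.1 l := by
  obtain ⟨m, hm⟩ := h
  refine ⟨a * m, ?_, ?_⟩
  · rw [mul_zsmul, natCast_zsmul, nsmul_unitFraction hm]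
  · rw [mul_zsmul, natCast_zsmul, y.2 hm]

theorem zsmul_eq_of_zsmul_unitFraction_eq (y : S.divisionFamilies A) {a b : ℤ}
    {k l : S.divisors} (h : a • unitFraction k = b • unitFraction l) :
    a • y.1 k = b • y.1 l := by
  obtain ⟨L, hkL, hlL⟩ := S.directed_dvd_divisors k l
  obtain ⟨a', ha, hya⟩ := exists_zsmul_unitFraction_eq_zsmul y a hkL
  obtain ⟨b', hb, hyb⟩ := exists_zsmul_unitFraction_eq_zsmul y b hlL
  have hab : a' = b' := zsmul_unitFraction_injective L (ha.symm.trans (h.trans hb))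
  rw [hya, hyb, hab]

theorem exists_addMonoidHom_unitFraction_eq (y : S.divisionFamilies A) :
    ∃ f : S.fractions →+ A, ∀ l, f (unitFraction l) = y.1 l := by
  choose num den eq_zsmul using exists_eq_zsmul_unitFraction (S := S)
  have value_eq {g : S.fractions} {a : ℤ} {l : S.divisors} (h : g = a • unitFraction l) :
      num g • y.1 (den g) = a • y.1 l :=
    zsmul_eq_of_zsmul_unitFraction_eq y ((eq_zsmul g).symm.trans h)
  refine ⟨AddMonoidHom.mk' (fun g => num g • y.1 (den g)) fun g h => ?_, fun l => ?_⟩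
  · obtain ⟨L, hgL, hhL⟩ := S.directed_dvd_divisors (den g) (den h)
    obtain ⟨a, ha, hya⟩ := exists_zsmul_unitFraction_eq_zsmul y (num g) hgL
    obtain ⟨b, hb, hyb⟩ := exists_zsmul_unitFraction_eq_zsmul y (num h) hhL
    rw [hya, hyb, ← add_zsmul]
    exact value_eq (by rw [add_zsmul, ← ha, ← hb, ← eq_zsmul, ← eq_zsmul])
  · exact (value_eq (one_zsmul _).symm).trans (one_zsmul _)

/-- Homomorphisms `G_S → A` as families in `A`, through their values at the unit fractions. -/
noncomputable def homEquivDivisionFamilies (S : Supernatural) (A : Type*) [AddCommGroup A] :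
    (S.fractions →+ A) ≃+ S.divisionFamilies A :=
  AddEquiv.ofBijective
    (AddMonoidHom.mk' (fun f => ⟨fun l => f (unitFraction l), fun k l m h => by
      rw [← map_nsmul, nsmul_unitFraction h]⟩) fun _ _ => rfl)
    ⟨fun _ _ h => addMonoidHom_ext_unitFraction fun l => congrFun (congrArg Subtype.val h) l,
      fun y => (exists_addMonoidHom_unitFraction_eq y).imp fun _ hf => Subtype.ext (funext hf)⟩

theorem homEquivDivisionFamilies_symm_unitFraction (y : S.divisionFamilies A) (l : S.divisors) :
    (S.homEquivDivisionFamilies A).symm y (unitFraction l) = y.1 l :=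
  congrArg (fun z : S.divisionFamilies A => z.1 l)
    ((S.homEquivDivisionFamilies A).apply_symm_apply y)

end DivisionFamily

section OdometerCharacter

/-- The character `1 / l ↦ x_l / l` of `G_S` given by a point `x` of `ℤ/Sℤ`. -/
noncomputable def character (S : Supernatural) :
    S.odometer →+ (S.fractions →+ UnitAddCircle) :=
  (S.homEquivDivisionFamilies UnitAddCircle).symm.toAddMonoidHom.comp <|
    AddMonoidHom.mk' (fun x => ⟨fun l => ZMod.toAddCircle (x.1 l), fun k l m h => by
      rw [← toAddCircle_castHom h, x.2 k l]⟩) fun x y =>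
        Subtype.ext (funext fun l => map_add ZMod.toAddCircle (x.1 l) (y.1 l))

theorem character_unitFraction (x : S.odometer) (l : S.divisors) :
    S.character x (unitFraction l) = ZMod.toAddCircle (x.1 l) :=
  homEquivDivisionFamilies_symm_unitFraction _ l

theorem character_injective (S : Supernatural) : Function.Injective S.character := fun x y h => by
  ext l
  apply ZMod.toAddCircle_injective
  rw [← character_unitFraction, h, character_unitFraction]

theorem character_unitFraction_one (x : S.odometer) : S.character x (unitFraction 1) = 0 := by
  have : Subsingleton (ZMod (((1 : S.divisors) : ℕ+) : ℕ)) :=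
    inferInstanceAs (Subsingleton (ZMod 1))
  rw [character_unitFraction, Subsingleton.elim (x.1 1) 0, map_zero]

theorem exists_character_eq {f : S.fractions →+ UnitAddCircle} (hf : f (unitFraction 1) = 0) :
    ∃ x, S.character x = f := by
  have torsion (l : S.divisors) : (l : ℕ) • f (unitFraction l) = 0 := by
    rw [← map_nsmul, nsmul_unitFraction_self, hf]
  choose y hy using fun l => exists_toAddCircle_eq (torsion l)
  refine ⟨⟨y, fun k l hkl => ?_⟩, addMonoidHom_ext_unitFraction fun l => ?_⟩
  · obtain ⟨m, hm⟩ := id hkl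
    apply ZMod.toAddCircle_injective
    rw [toAddCircle_castHom hm, hy, hy, ← map_nsmul, nsmul_unitFraction hm]
  · rw [character_unitFraction, hy]

/-- The character `g ↦ r g mod 1` of `G_S`. -/
noncomputable def scalarCharacter (S : Supernatural) (r : ℝ) : S.fractions →+ UnitAddCircle :=
  (QuotientAddGroup.mk' _).comp
    ((AddMonoidHom.mulLeft r).comp ((Rat.castHom ℝ).toAddMonoidHom.comp S.fractions.subtype))

theorem scalarCharacter_unitFraction (r : ℝ) (l : S.divisors) :
    S.scalarCharacter r (unitFraction l) = ((r / (l : ℕ) : ℝ) : UnitAddCircle) := by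
  change ((r * ((1 / (l : ℕ) : ℚ) : ℝ) : ℝ) : UnitAddCircle) = _
  rw [Rat.cast_div, Rat.cast_one, Rat.cast_natCast, mul_one_div]

theorem scalarCharacter_unitFraction_one (r : ℝ) :
    S.scalarCharacter r (unitFraction 1) = (r : UnitAddCircle) := by
  rw [scalarCharacter_unitFraction, coe_one_divisors, Nat.cast_one, div_one]

theorem extOfCharacter_scalarCharacter (S : Supernatural) (r : ℝ) :
    extOfCharacter S.fractions (S.scalarCharacter r) = 0 :=
  (extOfCharacter_eq_zero_iff _).2 ⟨_, fun _ => rfl⟩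

theorem exists_eq_scalarCharacter {f : S.fractions →+ UnitAddCircle}
    (hf : extOfCharacter S.fractions f = 0) : ∃ r, f = S.scalarCharacter r := by
  obtain ⟨h, hh⟩ := (extOfCharacter_eq_zero_iff f).1 hf
  refine ⟨h (unitFraction 1), addMonoidHom_ext_unitFraction fun l => ?_⟩
  have hl : ((l : ℕ) : ℝ) ≠ 0 := Nat.cast_ne_zero.2 l.1.ne_zero
  rw [scalarCharacter_unitFraction, ← hh, ← nsmul_unitFraction_self l, map_nsmul, nsmul_eq_mul,
    mul_div_cancel_left₀ _ hl]

theorem scalarCharacter_intCast (S : Supernatural) (a : ℤ) :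
    S.scalarCharacter a = S.character (S.q a) :=
  addMonoidHom_ext_unitFraction fun l => by
    rw [scalarCharacter_unitFraction, character_unitFraction]
    exact (ZMod.toAddCircle_intCast a).symm

end OdometerCharacter

/-- The homomorphism `ℤ/Sℤ → Ext¹(G_S, ℤ)` that sends a point to the pullback of `ℤ → ℝ → ℝ/ℤ` along
its character. -/
noncomputable def odometerToExt (S : Supernatural) :
    S.odometer →+ Ext (ModuleCat.of ℤ S.fractions) (ModuleCat.of ℤ ℤ) 1 :=
  (extOfCharacter S.fractions).comp S.character

theorem range_q_eq_ker_odometerToExt (S : Supernatural) : S.q.range = S.odometerToExt.ker := by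
  ext x
  constructor
  · rintro ⟨a, rfl⟩
    rw [AddMonoidHom.mem_ker, odometerToExt, AddMonoidHom.comp_apply, ← scalarCharacter_intCast,
      extOfCharacter_scalarCharacter]
  · intro hx
    obtain ⟨r, hr⟩ := exists_eq_scalarCharacter hx
    have r_eq_zero : (r : UnitAddCircle) = 0 := by
      rw [← scalarCharacter_unitFraction_one (S := S), ← hr, character_unitFraction_one]
    obtain ⟨a, rfl⟩ := (AddCircle.coe_eq_zero_iff 1).1 r_eq_zero
    rw [zsmul_one, scalarCharacter_intCast] at hr
    exact ⟨a, (S.character_injective hr).symm⟩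

theorem odometerToExt_surjective (S : Supernatural) : Function.Surjective S.odometerToExt := by
  intro e
  obtain ⟨f, rfl⟩ := extOfCharacter_surjective e
  obtain ⟨r, hr⟩ := QuotientAddGroup.mk_surjective (f (unitFraction 1))
  have sub_apply_one : (f - S.scalarCharacter r) (unitFraction 1) = 0 := by
    rw [AddMonoidHom.sub_apply, scalarCharacter_unitFraction_one, ← hr]
    exact sub_self _
  obtain ⟨x, hx⟩ := exists_character_eq sub_apply_one
  exact ⟨x, by rw [odometerToExt, AddMonoidHom.comp_apply, hx, map_sub,
    extOfCharacter_scalarCharacter, sub_zero]⟩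

end Supernatural

theorem mainTheorem9 (S : Supernatural) :
    Dense ((S.q.range : AddSubgroup S.odometer) : Set S.odometer) ∧
    Nonempty (CategoryTheory.Abelian.Ext (ModuleCat.of ℤ S.fractions) (ModuleCat.of ℤ ℤ) 1 ≃+
      S.odometer ⧸ S.q.range) := by
  exact ⟨S.dense_range_q,
    ⟨(QuotientAddGroup.liftEquiv _ S.odometerToExt_surjective
      S.range_q_eq_ker_odometerToExt).symm⟩⟩
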